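/- Let $N,K\ge 1$ and let $\mathbf R_1,\dots,\mathbf R_K\in\mathbb C^{N\times N}$. Write $\mathbb R_+=[0,\infty)$ and let $\mathcal S$ be the class of functions $g$ analytic on $\mathbb C\setminus\mathbb R_+$ such that $\operatorname{Im} g(z)\ge 0$ and $\operatorname{Im}(z g(z))\ge 0$ whenever $\operatorname{Im} z>0$, and such that $\lim_{y\to\infty}-\mathrm i y\,g(\mathrm i y)$ exists and is finite. Let $(\delta_1,\dots,\delta_K)\in\mathcal S^K$ be the solution of the equations $$\delta_j(z)=\frac1K\operatorname{tr}\mathbf R_j\mathbf R_j^{\mathsf H}\mathbf T(z),\quad j=1,\dots,K,\qquad \mathbf T(z)=\Big(\frac1K\sum_{j=1}^K\frac{\mathbf R_j\mathbf R_j^{\mathsf H}}{1+\delta_j(z)}-z\mathbf I_N\Big)^{-1},\qquad z\in\mathbb C\setminus\mathbb R_+,$$ and let $F$ be the probability distribution function, with support in $\mathbb R_+$, whose Stieltjes transform is $\int\frac{1}{\lambda-z}\,dF(\lambda)=\frac1N\operatorname{tr}\mathbf T(z)$ for $z\in\mathbb C\setminus\mathbb R_+$. Then for every $n\ge 0$ the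 moment $\bar\mu_n=\int_0^\infty\lambda^n\,dF(\lambda)$ is finite and $$\bar\mu_n=\frac{(-1)^n}{n!}\,\frac1N\operatorname{tr}\mathbf T_n,$$ where the matrices $\mathbf T_n$ are defined recursively by $\mathbf T_0=\mathbf I_N$, $f_{k,0}=-1$, $\delta_{k,0}=\frac1K\operatorname{tr}\mathbf R_k\mathbf R_k^{\mathsf H}$ for $k=1,\dots,K$ and, for $n\ge 0$, $$\mathbf T_{n+1}=\sum_{i=0}^n\sum_{j=0}^i\binom ni\binom ij\,\mathbf T_{n-i}\,\mathbf Q_{i-j+1}\,\mathbf T_j,\qquad \mathbf Q_{n+1}=\frac{n+1}K\sum_{k=1}^K f_{k,n}\,\mathbf R_k\mathbf R_k^{\mathsf H},$$ $$f_{k,n+1}=\sum_{i=0}^n\sum_{j=0}^i\binom ni\binom ij\,(n-i+1)\,f_{k,j}\,f_{k,i-j}\,\delta_{k,n-i},\qquad \delta_{k,n+1}=\frac1K\operatorname{tr}\mathbf R_k\mathbf R_k^{\mathsf H}\mathbf T_{n+1}.$$ -/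

import Mathlib

open MeasureTheory Filter
open scoped Topology Matrix

noncomputable section

namespace AsymptoticMoments

/-- The class `𝒮` of functions `f`, analytic on `ℂ ∖ ℝ₊` where `ℝ₊ = [0, ∞)`, such that `f z` and
`z * f z` lie in the upper half-plane for every `z` with positive imaginary part, and
`lim_{y → ∞} - i y f(i y)` exists and is finite. The half-plane in which the values lie is taken
closed: these are then exactly the Stieltjes transforms of the finite measures on `ℝ₊`, including
the zero measure (which occurs as soon as one of the matrices `R j` vanishes) and the point masses
at `0`. -/
structure ClassS (f : ℂ → ℂ) : Prop where
  analytic : AnalyticOnNhd ℂ f {z : ℂ | ∀ x : ℝ, 0 ≤ x → z ≠ (x : ℂ)}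
  im_nonneg : ∀ z : ℂ, 0 < z.im → 0 ≤ (f z).im
  im_mul_nonneg : ∀ z : ℂ, 0 < z.im → 0 ≤ (z * f z).im
  finite_limit : ∃ l : ℝ,
    Tendsto (fun y : ℝ => -Complex.I * (y : ℂ) * f (Complex.I * (y : ℂ))) atTop (𝓝 (l : ℂ))

section

variable {N K : ℕ} (R : Fin K → Matrix (Fin N) (Fin N) ℂ)

/-- `((1/K) ∑ⱼ Rⱼ Rⱼᴴ / (1 + dⱼ) - z I)⁻¹`, for given numbers `d₁, …, d_K`. -/
def detEquiv (d : Fin K → ℂ) (z : ℂ) : Matrix (Fin N) (Fin N) ℂ :=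
  ((1 / (K : ℂ)) • ∑ j, (1 / (1 + d j)) • (R j * (R j)ᴴ) - z • (1 : Matrix (Fin N) (Fin N) ℂ))⁻¹

/-- `δ = (δ₁, …, δ_K)` is a solution in `𝒮^K` of the implicit equations
`δⱼ(z) = (1/K) tr Rⱼ Rⱼᴴ T(z)` for `z ∈ ℂ ∖ ℝ₊`, where `T(z) = detEquiv R (δ(z)) z`. -/
structure IsFundamentalSolution (δ : Fin K → ℂ → ℂ) : Prop where
  mem_classS : ∀ j, ClassS (δ j)
  eqn : ∀ z : ℂ, (∀ x : ℝ, 0 ≤ x → z ≠ (x : ℂ)) → ∀ j,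
    δ j z = (1 / (K : ℂ)) * (R j * (R j)ᴴ * detEquiv R (fun i => δ i z) z).trace

/-- The probability distribution `F` on `ℝ` has the Stieltjes transform
`∫ 1/(λ - z) dF(λ) = (1/N) tr T(z)` on `ℂ ∖ ℝ₊`. A Stieltjes transform is defined off the support
of the distribution, so that `F` is carried by `ℝ₊`. Mathlib's `resolventTransform F z`, with `F`
on `ℝ` and `z : ℂ`, is the Stieltjes transform `∫ (λ - z)⁻¹ dF(λ)`. -/
structure IsDetEquivDistribution (F : Measure ℝ) : Prop where
  isProbabilityMeasure : IsProbabilityMeasure F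
  support_subset : F.support ⊆ Set.Ici 0
  stieltjes : ∃ δ : Fin K → ℂ → ℂ, IsFundamentalSolution R δ ∧
    ∀ z : ℂ, (∀ x : ℝ, 0 ≤ x → z ≠ (x : ℂ)) →
      resolventTransform F z = (1 / (N : ℂ)) * (detEquiv R (fun i => δ i z) z).trace

/-! The simultaneous recursion; the sums over `Fin (n + 1)` and `Fin (i + 1)` run over
`0 ≤ i ≤ n` and `0 ≤ j ≤ i`, and the lemmas below restate it with sums over ranges.
`Q₀` does not enter. -/
mutual

/-- The matrices `Tₙ`. -/
def T : ℕ → Matrix (Fin N) (Fin N) ℂ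
  | 0 => 1
  | n + 1 => ∑ i : Fin (n + 1), ∑ j : Fin (i.1 + 1),
      ((n.choose i.1 : ℂ) * (i.1.choose j.1 : ℂ)) • (T (n - i.1) * Q (i.1 - j.1 + 1) * T j.1)
termination_by n => 4 * n + 2
decreasing_by all_goals omega

/-- The matrices `Qₙ`, `n ≥ 1`. -/
def Q : ℕ → Matrix (Fin N) (Fin N) ℂ
  | 0 => 0
  | n + 1 => (((n : ℂ) + 1) / (K : ℂ)) • ∑ k, f k n • (R k * (R k)ᴴ)
termination_by n => 4 * n + 1
decreasing_by all_goals omega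

/-- The numbers `f_{k,n}`. -/
def f (k : Fin K) : ℕ → ℂ
  | 0 => -1
  | n + 1 => ∑ i : Fin (n + 1), ∑ j : Fin (i.1 + 1),
      (n.choose i.1 : ℂ) * (i.1.choose j.1 : ℂ) * ((n : ℂ) - (i.1 : ℂ) + 1) *
        f k j.1 * f k (i.1 - j.1) * delta k (n - i.1)
termination_by n => 4 * n
decreasing_by all_goals omega

/-- The numbers `δ_{k,n}`. -/
def delta (k : Fin K) : ℕ → ℂ
  | 0 => (1 / (K : ℂ)) * (R k * (R k)ᴴ).trace
  | n + 1 => (1 / (K : ℂ)) * (R k * (R k)ᴴ * T (n + 1)).trace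
termination_by n => 4 * n + 3
decreasing_by all_goals omega

end

theorem T_zero : T R 0 = 1 := by rw [T]

theorem f_zero (k : Fin K) : f R k 0 = -1 := by rw [f]

theorem delta_zero (k : Fin K) : delta R k 0 = (1 / (K : ℂ)) * (R k * (R k)ᴴ).trace := by
  rw [delta]

theorem T_succ (n : ℕ) : T R (n + 1) =
    ∑ i ∈ Finset.range (n + 1), ∑ j ∈ Finset.range (i + 1),
      ((n.choose i : ℂ) * (i.choose j : ℂ)) • (T R (n - i) * Q R (i - j + 1) * T R j) := by
  rw [T, Finset.sum_range]
  exact Finset.sum_congr rfl fun i _ => by rw [Finset.sum_range]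

theorem Q_succ (n : ℕ) : Q R (n + 1) =
    (((n : ℂ) + 1) / (K : ℂ)) • ∑ k, f R k n • (R k * (R k)ᴴ) := by
  rw [Q]

theorem f_succ (k : Fin K) (n : ℕ) : f R k (n + 1) =
    ∑ i ∈ Finset.range (n + 1), ∑ j ∈ Finset.range (i + 1),
      (n.choose i : ℂ) * (i.choose j : ℂ) * ((n : ℂ) - (i : ℂ) + 1) *
        f R k j * f R k (i - j) * delta R k (n - i) := by
  rw [f, Finset.sum_range]
  exact Finset.sum_congr rfl fun i _ => by rw [Finset.sum_range]

theorem delta_succ (k : Fin K) (n : ℕ) : delta R k (n + 1) =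
    (1 / (K : ℂ)) * (R k * (R k)ᴴ * T R (n + 1)).trace := by
  rw [delta]

end

end AsymptoticMoments

end

-- Put `u = -1/z` and `δ = u d`. Then `T(z) = u S(u)` with `S = (1 + u ∑ Bₖ/(1 + u dₖ))⁻¹`, `Bₖ = Rₖ
-- Rₖᴴ/K`, and the equations become `dₖ = tr Bₖ S`. At `u = 0` the right-hand side no longer depends
-- on `d`, so the implicit function theorem gives a solution analytic at `u = 0`, unique near `(0,
-- tr Bₖ)` (`exists_analytic_solution`). The finite limit in the class `𝒮` makes `δ/u` converge as
-- `z → i∞`, and the equations force the limit to be `tr Bₖ`; so the given solution is this analytic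
-- branch high on the imaginary axis (`eventually_detEquiv_eq`).
--
-- Hence `∫ (1 + uλ)⁻¹ dF = (1/N) tr S(u)` for small `u = it`, `t > 0`. Since the right side is
-- analytic at `0`, every moment exists and `(-1)ⁿ μₙ` is its `n`th Taylor coefficient
-- (`integrable_pow_and_integral_pow`). Leibniz' rule applied to differential equations for `S` and
-- `-1/(1 + u dₖ)` identifies `S⁽ⁿ⁾(0)` with `Tₙ` (`iteratedDeriv_perturbedResolvent`).

noncomputable section

namespace AsymptoticMoments

-- Moments of a measure from the Taylor expansion of its transform

/-- The remainder of the Taylor expansion of order `n`, divided by `u ^ n`, tends to the next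
coefficient. -/
theorem tendsto_taylor_remainder_div_pow {H : ℂ → ℂ} (hH : AnalyticAt ℂ H 0) (n : ℕ) :
    Tendsto (fun u : ℂ => (H u - ∑ k ∈ Finset.range n,
      iteratedDeriv k H 0 / (k.factorial : ℂ) * u ^ k) / u ^ n) (𝓝[≠] 0)
      (𝓝 (iteratedDeriv n H 0 / (n.factorial : ℂ))) := by
  have h := hH.hasFPowerSeriesAt.isBigO_sub_partialSum_pow (n + 1)
  simp only [zero_add, FormalMultilinearSeries.partialSum,
    FormalMultilinearSeries.apply_eq_prod_smul_coeff, Finset.prod_const, Finset.card_univ,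
    Fintype.card_fin, FormalMultilinearSeries.coeff_ofScalars, smul_eq_mul] at h
  have h0 : Tendsto (fun u : ℂ => (H u - ∑ k ∈ Finset.range (n + 1),
      u ^ k * (iteratedDeriv k H 0 / (k.factorial : ℂ))) / u ^ n) (𝓝[≠] 0) (𝓝 0) := by
    have h1 : (fun u : ℂ => ‖u‖ ^ (n + 1)) =o[𝓝 0] fun u : ℂ => u ^ n :=
      by simpa using (Asymptotics.isLittleO_pow_pow (𝕜 := ℂ) (Nat.lt_succ_self n)).norm_left
    exact ((h.trans_isLittleO h1).tendsto_div_nhds_zero).mono_left nhdsWithin_le_nhds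
  have h2 := h0.add_const (iteratedDeriv n H 0 / (n.factorial : ℂ))
  rw [zero_add] at h2
  refine h2.congr' ?_
  filter_upwards [self_mem_nhdsWithin] with u hu
  have hu : u ^ n ≠ 0 := pow_ne_zero _ hu
  rw [Finset.sum_range_succ]
  simp only [mul_comm (u ^ _)]
  field_simp
  ring

theorem one_le_norm_one_add_I_mul (t x : ℝ) : 1 ≤ ‖1 + Complex.I * t * x‖ := by
  refine le_trans ?_ (Complex.abs_re_le_norm _)
  simp

theorem one_add_I_mul_ne_zero (t x : ℝ) : 1 + Complex.I * t * x ≠ 0 := fun h => by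
  have := one_le_norm_one_add_I_mul t x
  rw [h, norm_zero] at this
  linarith

theorem continuous_pow_mul_inv_one_add (n : ℕ) (t : ℝ) :
    Continuous fun x : ℝ => (x : ℂ) ^ n * (1 + Complex.I * t * x)⁻¹ := by
  refine (by fun_prop : Continuous fun x : ℝ => (x : ℂ) ^ n).mul (Continuous.inv₀ (by fun_prop) ?_)
  exact one_add_I_mul_ne_zero t

theorem re_pow_mul_inv_one_add (n : ℕ) (t x : ℝ) :
    ((x : ℂ) ^ n * (1 + Complex.I * t * x)⁻¹).re = x ^ n * (1 + t ^ 2 * x ^ 2)⁻¹ := by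
  rw [← Complex.ofReal_pow, Complex.re_ofReal_mul, Complex.inv_re, Complex.normSq_apply]
  simp
  ring_nf
  simp

/-- The geometric sum with its exact remainder: a damped `n`th moment becomes a Taylor remainder of
the transform. -/
theorem pow_mul_inv_one_add_eq (n : ℕ) {u x : ℂ} (hu : u ≠ 0) (hx : 1 + u * x ≠ 0) :
    x ^ n * (1 + u * x)⁻¹ =
      (-1) ^ n / u ^ n * ((1 + u * x)⁻¹ - ∑ k ∈ Finset.range n, (-u) ^ k * x ^ k) := by
  have h := mul_neg_geom_sum (-u * x) n
  have h' : ∑ k ∈ Finset.range n, (-u) ^ k * x ^ k =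
      (1 + u * x)⁻¹ * (1 - (-u * x) ^ n) := by
    rw [← h, ← mul_assoc, show (1 - -u * x) = 1 + u * x by ring, inv_mul_cancel₀ hx, one_mul]
    exact Finset.sum_congr rfl fun k _ => (mul_pow _ _ _).symm
  rw [h', mul_pow, neg_pow u]
  have hu' : u ^ n ≠ 0 := pow_ne_zero _ hu
  have h1 : ((-1 : ℂ) ^ n) * (-1) ^ n = 1 := by rw [← mul_pow]; simp
  field_simp
  linear_combination (-1 : ℂ) * x ^ n * u ^ n * h1

/-- If the transform `∫ 1/(1 + uλ) dF(λ)` of a finite measure on `[0, ∞)` agrees along the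
positive imaginary axis near `0` with a function analytic at `0`, then all moments of `F` are
finite and are given by the Taylor coefficients of that function. -/
theorem integrable_pow_and_integral_pow {F : Measure ℝ} [IsFiniteMeasure F]
    (hF : ∀ᵐ x ∂F, 0 ≤ x) {H : ℂ → ℂ} (hH : AnalyticAt ℂ H 0)
    (h : ∀ᶠ t : ℝ in 𝓝[>] 0, ∫ x : ℝ, (1 + Complex.I * t * x)⁻¹ ∂F = H (Complex.I * t)) (n : ℕ) :
    Integrable (fun x : ℝ => x ^ n) F ∧
      ((∫ x, x ^ n ∂F : ℝ) : ℂ) = (-1) ^ n * (iteratedDeriv n H 0 / (n.factorial : ℂ)) := by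
  induction n using Nat.strong_induction_on with
  | _ n ih =>
  set c : ℂ := (-1) ^ n * (iteratedDeriv n H 0 / (n.factorial : ℂ))
  have hint0 (t : ℝ) : Integrable (fun x : ℝ => (1 + Complex.I * t * x)⁻¹) F := by
    refine Integrable.of_bound (C := 1) ?_ (ae_of_all _ fun x => ?_)
    · simpa using (continuous_pow_mul_inv_one_add 0 t).aestronglyMeasurable
    · rw [norm_inv]
      exact inv_le_one_of_one_le₀ (one_le_norm_one_add_I_mul t x)
  have hintk (k : ℕ) (hk : k < n) (a : ℂ) : Integrable (fun x : ℝ => a * (x : ℂ) ^ k) F := by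
    simpa using ((ih k hk).1.ofReal (𝕜 := ℂ)).const_mul a
  have hintsum (u : ℂ) :
      Integrable (fun x : ℝ => ∑ k ∈ Finset.range n, (-u) ^ k * (x : ℂ) ^ k) F :=
    integrable_finsetSum _ fun k hk => hintk k (Finset.mem_range.1 hk) _
  have hpt (t : ℝ) (ht : 0 < t) (x : ℝ) := pow_mul_inv_one_add_eq n
    (mul_ne_zero Complex.I_ne_zero (Complex.ofReal_ne_zero.2 ht.ne')) (one_add_I_mul_ne_zero t x)
  have hint (t : ℝ) (ht : 0 < t) :
      Integrable (fun x : ℝ => (x : ℂ) ^ n * (1 + Complex.I * t * x)⁻¹) F := by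
    simp only [hpt t ht]
    exact ((hint0 t).sub (hintsum _)).const_mul _
  -- By induction the lower moments match the Taylor coefficients of `H`, so the damped moment is
  -- the remainder of `H` of order `n`, up to the factor `(-1)ⁿ/uⁿ`.
  have hlim : Tendsto (fun t : ℝ => ∫ x : ℝ, (x : ℂ) ^ n * (1 + Complex.I * t * x)⁻¹ ∂F)
      (𝓝[>] 0) (𝓝 c) := by
    have hI : Tendsto (fun t : ℝ => Complex.I * (t : ℂ)) (𝓝[>] 0) (𝓝[≠] 0) := by
      refine tendsto_nhdsWithin_iff.2 ⟨?_, ?_⟩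
      · have : Continuous fun t : ℝ => Complex.I * (t : ℂ) := by fun_prop
        simpa using (this.tendsto 0).mono_left nhdsWithin_le_nhds
      · filter_upwards [self_mem_nhdsWithin] with t ht
        exact mul_ne_zero Complex.I_ne_zero (Complex.ofReal_ne_zero.2 (ne_of_gt ht))
    refine (((tendsto_taylor_remainder_div_pow hH n).comp hI).const_mul ((-1) ^ n)).congr' ?_
    filter_upwards [h, self_mem_nhdsWithin] with t ht ht0
    simp only [hpt t ht0, Function.comp_apply]
    rw [integral_const_mul, integral_sub (hint0 t) (hintsum _), ht,
      integral_finsetSum _ fun k hk => hintk k (Finset.mem_range.1 hk) _, mul_div_assoc',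
      div_mul_eq_mul_div]
    congr 3
    refine Finset.sum_congr rfl fun k hk => ?_
    have := (ih k (Finset.mem_range.1 hk)).2
    rw [integral_const_mul]
    simp only [← Complex.ofReal_pow]
    rw [integral_complex_ofReal, this, neg_pow]
    have h1 : ((-1 : ℂ) ^ k) * (-1) ^ k = 1 := by rw [← mul_pow]; simp
    linear_combination (-1 : ℂ) * (Complex.I * t) ^ k *
      (iteratedDeriv k H 0 / (k.factorial : ℂ)) * h1
  have hseq : Tendsto (fun m : ℕ => 1 / ((m : ℝ) + 1)) atTop (𝓝[>] 0) :=
    tendsto_nhdsWithin_iff.2 ⟨tendsto_one_div_add_atTop_nhds_zero_nat,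
      Eventually.of_forall fun m => by simp only [Set.mem_Ioi]; positivity⟩
  have hpos (m : ℕ) : 0 < 1 / ((m : ℝ) + 1) := by positivity
  have hlimseq := hlim.comp hseq
  have hseq0 := tendsto_one_div_add_atTop_nhds_zero_nat (𝕜 := ℝ)
  have hintn : Integrable (fun x : ℝ => x ^ n) F := by
    -- Fatou: on `[0, ∞)` the real parts of the damped powers are nonnegative, tend to `xⁿ`, and
    -- have integrals converging to `c.re`.
    refine integrable_of_tendsto
      (G := fun (m : ℕ) x => x ^ n * (1 + (1 / ((m : ℝ) + 1)) ^ 2 * x ^ 2)⁻¹)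
      (ae_of_all _ fun x => ?_) (fun m => ?_) ?_
    · have := (((hseq0.pow 2).mul_const (x ^ 2)).const_add 1).inv₀ (by simp)
      simpa using this.const_mul (x ^ n)
    · simp only [← re_pow_mul_inv_one_add]
      exact (Complex.continuous_re.comp
        (continuous_pow_mul_inv_one_add n _)).aestronglyMeasurable
    · have key (m : ℕ) : ∫⁻ x : ℝ, ‖x ^ n * (1 + (1 / ((m : ℝ) + 1)) ^ 2 * x ^ 2)⁻¹‖ₑ ∂F =
          ENNReal.ofReal
            (∫ x : ℝ, (x : ℂ) ^ n * (1 + Complex.I * (1 / ((m : ℝ) + 1) : ℝ) * x)⁻¹ ∂F).re := by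
        have hre := integral_re (hint _ (hpos m))
        have hint' := (hint _ (hpos m)).re
        simp only [RCLike.re_eq_complex_re] at hre hint'
        rw [← hre, ofReal_integral_eq_lintegral_ofReal hint']
        · refine lintegral_congr_ae ?_
          filter_upwards [hF] with x hx
          rw [Real.enorm_eq_ofReal (by positivity), re_pow_mul_inv_one_add]
        · filter_upwards [hF] with x hx
          simp only [Pi.zero_apply]
          rw [re_pow_mul_inv_one_add]
          positivity
      simp only [key]
      have : Tendsto (fun m : ℕ => ENNReal.ofReal (∫ x : ℝ, (x : ℂ) ^ n *
          (1 + Complex.I * (1 / ((m : ℝ) + 1) : ℝ) * x)⁻¹ ∂F).re) atTop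
          (𝓝 (ENNReal.ofReal c.re)) := (ENNReal.continuous_ofReal.tendsto _).comp
        ((Complex.continuous_re.tendsto _).comp hlimseq)
      rw [this.liminf_eq]
      exact ENNReal.ofReal_ne_top
  refine ⟨hintn, ?_⟩
  refine tendsto_nhds_unique (f := fun m : ℕ => ∫ x : ℝ, (x : ℂ) ^ n *
    (1 + Complex.I * (1 / ((m : ℝ) + 1) : ℝ) * x)⁻¹ ∂F) ?_ hlimseq
  rw [← integral_complex_ofReal]
  -- With `xⁿ` now integrable, `1 ≤ |1 + itx|` gives domination.
  refine tendsto_integral_of_dominated_convergence (fun x => ‖x ^ n‖)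
    (fun m => (continuous_pow_mul_inv_one_add n _).aestronglyMeasurable) hintn.norm
    (fun m => ae_of_all _ fun x => ?_) (ae_of_all _ fun x => ?_)
  · rw [norm_mul, norm_inv, ← Complex.ofReal_pow, Complex.norm_real]
    exact mul_le_of_le_one_right (norm_nonneg _)
      (inv_le_one_of_one_le₀ (one_le_norm_one_add_I_mul _ x))
  · have h1 : Tendsto (fun m : ℕ => ((1 / ((m : ℝ) + 1) : ℝ) : ℂ)) atTop (𝓝 0) := by
      simpa only [Complex.ofReal_zero] using! (Complex.continuous_ofReal.tendsto 0).comp hseq0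
    have := ((((h1.const_mul Complex.I).mul_const (x : ℂ)).const_add 1).inv₀ (by simp)).const_mul
      ((x : ℂ) ^ n)
    simpa only [mul_zero, zero_mul, add_zero, inv_one, mul_one, Complex.ofReal_pow] using this

-- Leibniz formulas for iterated derivatives

section IteratedDeriv

theorem iteratedDeriv_clm_comp {E G : Type*} [NormedAddCommGroup E] [NormedSpace ℂ E]
    [NormedAddCommGroup G] [NormedSpace ℂ G] (L : E →L[ℂ] G) {g : ℂ → E} {x : ℂ} (n : ℕ)
    (hg : ContDiffAt ℂ n g x) :
    iteratedDeriv n (fun u => L (g u)) x = L (iteratedDeriv n g x) := by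
  simp only [iteratedDeriv]
  rw [show (fun u => L (g u)) = L ∘ g from rfl, L.iteratedFDeriv_comp_left hg le_rfl]
  rfl

/-- Only the Leibniz term differentiating `u` exactly once survives at `0`. This produces the
factors `n + 1` and `n - i + 1` in the recursions. -/
theorem iteratedDeriv_succ_id_mul (n : ℕ) {g : ℂ → ℂ} (hg : ContDiffAt ℂ (n + 1 : ℕ) g 0) :
    iteratedDeriv (n + 1) (fun u => u * g u) 0 = ((n : ℂ) + 1) * iteratedDeriv n g 0 := by
  rw [iteratedDeriv_fun_mul (f := fun u : ℂ => u) contDiffAt_id hg, Finset.sum_eq_single 1]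
  · simp [iteratedDeriv_one]
  · intro i _ hi
    rcases i with _ | _ | i
    · simp
    · exact absurd rfl hi
    · have : iteratedDeriv (i + 1 + 1) (fun x : ℂ => x) 0 = 0 := by
        rw [iteratedDeriv_succ', iteratedDeriv_succ']
        simp
      simp [this]
  · simp

theorem iteratedDeriv_mul_mul {𝔸 : Type*} [NormedRing 𝔸] [NormedAlgebra ℂ 𝔸] (n : ℕ)
    {A B C : ℂ → 𝔸} {x : ℂ} (hA : ContDiffAt ℂ n A x) (hB : ContDiffAt ℂ n B x)
    (hC : ContDiffAt ℂ n C x) :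
    iteratedDeriv n (fun u => A u * (B u * C u)) x =
      ∑ i ∈ Finset.range (n + 1), ∑ j ∈ Finset.range (i + 1),
        ((n.choose i : ℂ) * (i.choose j : ℂ)) •
          (iteratedDeriv (n - i) A x * iteratedDeriv (i - j) B x * iteratedDeriv j C x) := by
  have leibniz (m : ℕ) (hm : m ≤ n) {f g : ℂ → 𝔸} (hf : ContDiffAt ℂ n f x)
      (hg : ContDiffAt ℂ n g x) : iteratedDeriv m (fun u => f u * g u) x =
        ∑ i ∈ Finset.range (m + 1), (m.choose i : ℂ) •
          (iteratedDeriv (m - i) f x * iteratedDeriv i g x) := by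
    have hm' : (m : WithTop ℕ∞) ≤ n := by exact_mod_cast hm
    rw [iteratedDeriv_fun_mul (hf.of_le hm') (hg.of_le hm'), ← Finset.sum_range_reflect]
    refine Finset.sum_congr rfl fun i hi => ?_
    have hi : i ≤ m := Nat.lt_succ_iff.1 (Finset.mem_range.1 hi)
    rw [show m + 1 - 1 - i = m - i by omega, Nat.choose_symm hi, Nat.sub_sub_self hi, mul_assoc,
      Nat.cast_smul_eq_nsmul, nsmul_eq_mul]
  rw [leibniz n le_rfl hA (hB.mul hC)]
  refine Finset.sum_congr rfl fun i hi => ?_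
  rw [leibniz i (Nat.lt_succ_iff.1 (Finset.mem_range.1 hi)) hB hC, Finset.mul_sum,
    Finset.smul_sum]
  refine Finset.sum_congr rfl fun j _ => ?_
  rw [mul_smul_comm, smul_smul, mul_assoc]

end IteratedDeriv

-- The analytic branch at infinity and its Taylor coefficients

section Resolvent

variable {𝔸 : Type*} [NormedRing 𝔸] [NormedAlgebra ℂ 𝔸] {ι : Type*} [Fintype ι]
  (B : ι → 𝔸) (L : ι → 𝔸 →L[ℂ] ℂ)

/-- `(1 + u ∑ₖ Bₖ / (1 + u dₖ))⁻¹`, for `p = (u, d)`. -/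
def perturbedResolvent (p : ℂ × (ι → ℂ)) : 𝔸 :=
  Ring.inverse (1 + p.1 • ∑ k, (1 + p.1 * p.2 k)⁻¹ • B k)

/-- The right-hand side of the implicit equations
`dₖ = Lₖ ((1 + u ∑ⱼ Bⱼ / (1 + u dⱼ))⁻¹)`. -/
def fixedPointMap (p : ℂ × (ι → ℂ)) : ι → ℂ :=
  fun k => L k (perturbedResolvent B p)

theorem perturbedResolvent_zero (d : ι → ℂ) : perturbedResolvent B (0, d) = 1 := by
  simp [perturbedResolvent]

theorem fixedPointMap_zero (d : ι → ℂ) : fixedPointMap B L (0, d) = fun k => L k 1 := by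
  funext k
  rw [fixedPointMap, perturbedResolvent_zero]

theorem contDiffAt_perturbedPencil (d : ι → ℂ) {n : WithTop ℕ∞} :
    ContDiffAt ℂ n (fun p : ℂ × (ι → ℂ) => 1 + p.1 • ∑ k, (1 + p.1 * p.2 k)⁻¹ • B k) (0, d) := by
  refine contDiffAt_const.add (ContDiffAt.smul contDiffAt_fst (ContDiffAt.sum fun k _ => ?_))
  have h : ContDiffAt ℂ n (fun p : ℂ × (ι → ℂ) => 1 + p.1 * p.2 k) (0, d) := by fun_prop
  exact (h.inv (by simp)).smul contDiffAt_const

variable [CompleteSpace 𝔸]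

theorem contDiffAt_perturbedResolvent (d : ι → ℂ) {n : WithTop ℕ∞} :
    ContDiffAt ℂ n (perturbedResolvent B) (0, d) := by
  refine ContDiffAt.comp (g := Ring.inverse) (0, d) ?_ (contDiffAt_perturbedPencil B d)
  simpa using! contDiffAt_ringInverse ℂ (1 : 𝔸ˣ)

theorem contDiffAt_fixedPointMap (d : ι → ℂ) {n : WithTop ℕ∞} :
    ContDiffAt ℂ n (fixedPointMap B L) (0, d) :=
  contDiffAt_pi.2 fun k =>
    (L k).contDiff.contDiffAt.comp _ (contDiffAt_perturbedResolvent B d)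

/-- Near `u = 0` the equation `d = fixedPointMap B L (u, d)` has one and only one solution `d`
close to its value at `u = 0`, and it depends analytically on `u`. -/
theorem exists_analytic_solution : ∃ d : ℂ → ι → ℂ, AnalyticAt ℂ d 0 ∧
    (∀ᶠ u in 𝓝 0, d u = fixedPointMap B L (u, d u)) ∧
    ∀ᶠ p in 𝓝 ((0 : ℂ), fun k => L k 1), p.2 = fixedPointMap B L p → p.2 = d p.1 := by
  set d₀ : ι → ℂ := fun k => L k 1
  have hcd : ContDiffAt ℂ ⊤ (fun p : ℂ × (ι → ℂ) => p.2 - fixedPointMap B L p) (0, d₀) :=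
    contDiffAt_snd.sub (contDiffAt_fixedPointMap B L d₀)
  -- At `u = 0` the fixed-point map is constant in `d`, so the partial derivative in `d` is the
  -- identity.
  have hinv : (fderiv ℂ (fun p : ℂ × (ι → ℂ) => p.2 - fixedPointMap B L p) (0, d₀) ∘L
      .inr ℂ ℂ (ι → ℂ)).IsInvertible := by
    have h1 := (hcd.differentiableAt (by simp)).hasFDerivAt.comp d₀
      (hasFDerivAt_prodMk_right (𝕜 := ℂ) (0 : ℂ) d₀)
    have h2 : HasFDerivAt ((fun p : ℂ × (ι → ℂ) => p.2 - fixedPointMap B L p) ∘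
        fun d => ((0 : ℂ), d)) (ContinuousLinearMap.id ℂ (ι → ℂ)) d₀ := by
      refine ((hasFDerivAt_id d₀).sub_const d₀).congr_of_eventuallyEq
        (Eventually.of_forall fun d => ?_)
      simp [fixedPointMap_zero, d₀]
    rw [h1.unique h2]
    exact ⟨ContinuousLinearEquiv.refl ℂ _, rfl⟩
  have hzero : d₀ - fixedPointMap B L (0, d₀) = 0 := by rw [fixedPointMap_zero, sub_self]
  refine ⟨hcd.implicitFunction (by simp) hinv,
    (hcd.contDiffAt_implicitFunction (by simp) hinv).analyticAt, ?_, ?_⟩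
  · filter_upwards [hcd.eventually_apply_implicitFunction (by simp) hinv] with u hu
    rw [hzero] at hu
    exact sub_eq_zero.1 hu
  · filter_upwards [hcd.eventually_apply_eq_iff_implicitFunction (by simp) hinv] with p hp hp'
    refine (hp.1 ?_).symm
    rw [hzero, ← hp', sub_self]

theorem analyticAt_perturbedResolvent {d : ℂ → ι → ℂ} (hd : AnalyticAt ℂ d 0) :
    AnalyticAt ℂ (fun u => perturbedResolvent B (u, d u)) 0 :=
  (ContDiffAt.comp (n := ⊤) (g := perturbedResolvent B) (f := fun u => (u, d u)) (0 : ℂ)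
    (contDiffAt_perturbedResolvent B (d 0))
    (contDiffAt_id.prodMk hd.contDiffAt)).analyticAt

/-- The Taylor coefficients at `0` of an analytic solution satisfy a recursion, obtained from the
differential equations `S' = S q' S` and `gₖ' = (u dₖ)' gₖ²` for `gₖ = -1 / (1 + u dₖ)` and
`S = (1 - q)⁻¹`, `q = u ∑ₖ gₖ Bₖ`. -/
theorem iteratedDeriv_perturbedResolvent {d : ℂ → ι → ℂ} (hd : AnalyticAt ℂ d 0)
    (hfix : ∀ᶠ u in 𝓝 0, d u = fixedPointMap B L (u, d u)) {τ : ℕ → 𝔸} {φ : ι → ℕ → ℂ}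
    (hτ0 : τ 0 = 1) (hφ0 : ∀ k, φ k 0 = -1)
    (hτ : ∀ n, τ (n + 1) = ∑ i ∈ Finset.range (n + 1), ∑ j ∈ Finset.range (i + 1),
      ((n.choose i : ℂ) * (i.choose j : ℂ)) •
        (τ (n - i) * (∑ k, (((i - j : ℕ) + 1 : ℂ) * φ k (i - j)) • B k) * τ j))
    (hφ : ∀ k n, φ k (n + 1) = ∑ i ∈ Finset.range (n + 1), ∑ j ∈ Finset.range (i + 1),
      ((n.choose i : ℂ) * (i.choose j : ℂ)) •
        ((((n - i : ℕ) + 1 : ℂ) * L k (τ (n - i))) * φ k (i - j) * φ k j)) (n : ℕ) :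
    iteratedDeriv n (fun u => perturbedResolvent B (u, d u)) 0 = τ n := by
  have hSan := analyticAt_perturbedResolvent B hd
  set S : ℂ → 𝔸 := fun u => perturbedResolvent B (u, d u) with hS
  set g : ι → ℂ → ℂ := fun k u => -(1 + u * d u k)⁻¹ with hg
  set q : ℂ → 𝔸 := fun u => ∑ k, (u * g k u) • B k with hq
  have hdk (k : ι) : AnalyticAt ℂ (fun u => d u k) 0 := analyticAt_pi_iff.1 hd k
  have hudk (k : ι) : AnalyticAt ℂ (fun u => u * d u k) 0 := analyticAt_id.mul (hdk k)
  have hgan (k : ι) : AnalyticAt ℂ (g k) 0 :=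
    ((analyticAt_const.add (hudk k)).inv (by simp)).neg
  have hugan (k : ι) : AnalyticAt ℂ (fun u => u * g k u) 0 := analyticAt_id.mul (hgan k)
  have hBan (k : ι) : AnalyticAt ℂ (fun u => (u * g k u) • B k) 0 :=
    (hugan k).smul analyticAt_const
  have hqan : AnalyticAt ℂ q 0 := Finset.analyticAt_fun_sum _ fun k _ => hBan k
  have hSq (u : ℂ) : S u = Ring.inverse (1 - q u) := by
    simp only [hS, perturbedResolvent, hq, hg]
    congr 1
    rw [sub_eq_add_neg, ← Finset.sum_neg_distrib, Finset.smul_sum]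
    congr 1
    refine Finset.sum_congr rfl fun k _ => ?_
    rw [smul_smul, ← neg_smul]
    congr 1
    ring
  have hS' : deriv S =ᶠ[𝓝 0] fun u => S u * (deriv q u * S u) := by
    have hunit : ∀ᶠ u in 𝓝 0, IsUnit (1 - q u) := by
      have : Tendsto (fun u => 1 - q u) (𝓝 0) (𝓝 (1 - q 0)) :=
        tendsto_const_nhds.sub hqan.continuousAt
      rw [show 1 - q 0 = ((1 : 𝔸ˣ) : 𝔸) by simp [hq]] at this
      exact this.eventually (Units.nhds 1)
    filter_upwards [hunit, hqan.eventually_analyticAt] with u hu hqu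
    obtain ⟨a, ha⟩ := hu
    have h1 := hasFDerivAt_ringInverse (𝕜 := ℂ) a
    rw [ha] at h1
    have h2 := h1.comp_hasDerivAt u (hqu.differentiableAt.hasDerivAt.const_sub 1)
    have h3 : S = Ring.inverse ∘ fun u => 1 - q u := funext hSq
    rw [hSq u, h3, h2.deriv, ← ha, Ring.inverse_unit]
    simp [mul_assoc]
  have hg' (k : ι) : deriv (g k) =ᶠ[𝓝 0]
      fun u => deriv (fun v => v * d v k) u * (g k u * g k u) := by
    have hne : ∀ᶠ u in 𝓝 0, 1 + u * d u k ≠ 0 :=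
      ContinuousAt.eventually_ne (analyticAt_const.add (hudk k)).continuousAt (by simp)
    filter_upwards [hne, (hudk k).eventually_analyticAt] with u hu hdu
    have h2 : HasDerivAt (g k) _ u := ((hdu.differentiableAt.hasDerivAt.const_add 1).inv hu).neg
    rw [h2.deriv, hg]
    field_simp
  -- The fixed-point equation transfers Taylor coefficients from `S` to `d`.
  have hdn (k : ι) (m : ℕ) (hm : iteratedDeriv m S 0 = τ m) :
      iteratedDeriv m (fun u => d u k) 0 = L k (τ m) := by
    have hd' : (fun u => d u k) =ᶠ[𝓝 0] fun u => L k (S u) := by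
      filter_upwards [hfix] with u hu
      exact congrFun hu k
    rw [hd'.iteratedDeriv_eq, iteratedDeriv_clm_comp _ _ hSan.contDiffAt, hm]
  have hqn (m : ℕ) (hm : ∀ k, iteratedDeriv m (g k) 0 = φ k m) :
      iteratedDeriv m (deriv q) 0 = ∑ k, ((m + 1 : ℂ) * φ k m) • B k := by
    rw [← iteratedDeriv_succ', hq, iteratedDeriv_fun_sum fun k _ => (hBan k).contDiffAt]
    refine Finset.sum_congr rfl fun k _ => ?_
    rw [← hm k, ← iteratedDeriv_succ_id_mul m (hgan k).contDiffAt]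
    exact iteratedDeriv_clm_comp ((ContinuousLinearMap.id ℂ ℂ).smulRight (B k)) (m + 1)
      (hugan k).contDiffAt
  -- The two families are coupled: each coefficient of order `n + 1` involves both families up to
  -- order `n`, so they are treated in one strong induction.
  suffices h : ∀ n, ∀ m ≤ n, iteratedDeriv m S 0 = τ m ∧
      ∀ k, iteratedDeriv m (g k) 0 = φ k m from (h n n le_rfl).1
  intro n
  induction n with
  | zero =>
    intro m hm
    obtain rfl : m = 0 := by omega
    simp [hS, hg, perturbedResolvent_zero, hτ0, hφ0]
  | succ n ih =>
    intro m hm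
    rcases Nat.lt_or_ge m (n + 1) with h | h
    · exact ih m (by omega)
    obtain rfl : m = n + 1 := by omega
    refine ⟨?_, fun k => ?_⟩
    · rw [iteratedDeriv_succ', hS'.iteratedDeriv_eq,
        iteratedDeriv_mul_mul n hSan.contDiffAt hqan.deriv.contDiffAt hSan.contDiffAt, hτ]
      refine Finset.sum_congr rfl fun i hi => Finset.sum_congr rfl fun j hj => ?_
      rw [Finset.mem_range] at hi hj
      rw [(ih (n - i) (by omega)).1, hqn (i - j) (ih _ (by omega)).2, (ih j (by omega)).1]
    · rw [iteratedDeriv_succ', (hg' k).iteratedDeriv_eq,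
        iteratedDeriv_mul_mul n (hudk k).deriv.contDiffAt
          (hgan k).contDiffAt (hgan k).contDiffAt, hφ]
      refine Finset.sum_congr rfl fun i hi => Finset.sum_congr rfl fun j hj => ?_
      rw [Finset.mem_range] at hi hj
      rw [← iteratedDeriv_succ', iteratedDeriv_succ_id_mul _ (hdk k).contDiffAt,
        hdn k _ (ih (n - i) (by omega)).1, (ih (i - j) (by omega)).2 k, (ih j (by omega)).2 k]

end Resolvent

-- Specialization to matrices and identification of the branch

section Matrices

open scoped Matrix.Norms.Operator

variable {N K : ℕ} (R : Fin K → Matrix (Fin N) (Fin N) ℂ)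

/-- The matrices `(1/K) Rₖ Rₖᴴ`. -/
def gram (k : Fin K) : Matrix (Fin N) (Fin N) ℂ := (1 / (K : ℂ)) • (R k * (R k)ᴴ)

/-- The linear functionals `M ↦ (1/K) tr Rₖ Rₖᴴ M`. -/
def gramTrace (k : Fin K) : Matrix (Fin N) (Fin N) ℂ →L[ℂ] ℂ :=
  LinearMap.toContinuousLinearMap
    (Matrix.traceLinearMap (Fin N) ℂ ℂ ∘ₗ LinearMap.mulLeft ℂ (gram R k))

theorem gramTrace_apply (k : Fin K) (M : Matrix (Fin N) (Fin N) ℂ) :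
    gramTrace R k M = (1 / (K : ℂ)) * (R k * (R k)ᴴ * M).trace := by
  change (gram R k * M).trace = _
  rw [gram, smul_mul_assoc, Matrix.trace_smul, smul_eq_mul]

/-- The normalized trace `M ↦ (1/N) tr M`. -/
def normalizedTrace (N : ℕ) : Matrix (Fin N) (Fin N) ℂ →L[ℂ] ℂ :=
  LinearMap.toContinuousLinearMap ((1 / (N : ℂ)) • Matrix.traceLinearMap (Fin N) ℂ ℂ)

theorem normalizedTrace_apply (M : Matrix (Fin N) (Fin N) ℂ) :
    normalizedTrace N M = (1 / (N : ℂ)) * M.trace :=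
  rfl

theorem delta_eq_gramTrace (k : Fin K) (n : ℕ) : delta R k n = gramTrace R k (T R n) := by
  rw [gramTrace_apply]
  cases n with
  | zero => rw [T_zero, delta_zero, mul_one]
  | succ n => rw [delta_succ]

theorem f_succ_eq_gramTrace (k : Fin K) (n : ℕ) : f R k (n + 1) =
    ∑ i ∈ Finset.range (n + 1), ∑ j ∈ Finset.range (i + 1),
      ((n.choose i : ℂ) * (i.choose j : ℂ)) •
        ((((n - i : ℕ) + 1 : ℂ) * gramTrace R k (T R (n - i))) * f R k (i - j) * f R k j) := by
  rw [f_succ]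
  refine Finset.sum_congr rfl fun i hi => Finset.sum_congr rfl fun j _ => ?_
  rw [delta_eq_gramTrace, Nat.cast_sub (Nat.lt_succ_iff.1 (Finset.mem_range.1 hi)), smul_eq_mul]
  ring

theorem iteratedDeriv_normalizedTrace_perturbedResolvent {d : ℂ → Fin K → ℂ}
    (hd : AnalyticAt ℂ d 0)
    (hfix : ∀ᶠ u in 𝓝 0, d u = fixedPointMap (gram R) (gramTrace R) (u, d u)) (n : ℕ) :
    iteratedDeriv n (fun u => normalizedTrace N (perturbedResolvent (gram R) (u, d u))) 0 =
      normalizedTrace N (T R n) := by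
  refine (iteratedDeriv_clm_comp (normalizedTrace N) n
    (analyticAt_perturbedResolvent (gram R) hd).contDiffAt).trans (congrArg (normalizedTrace N)
    (iteratedDeriv_perturbedResolvent (gram R) (gramTrace R) hd hfix (T_zero R) (f_zero R) ?_
    (f_succ_eq_gramTrace R) n))
  intro n
  rw [T_succ]
  refine Finset.sum_congr rfl fun i _ => Finset.sum_congr rfl fun j _ => ?_
  rw [Q_succ, Finset.smul_sum]
  congr 4
  funext k
  rw [gram, smul_smul, smul_smul]
  congr 1
  ring

/-- In the variables `u = -1/z` and `d = δ/u`, the matrix `T(z)` is `u` times the perturbed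
resolvent of the matrices `(1/K) Rₖ Rₖᴴ`. -/
theorem detEquiv_eq_smul_perturbedResolvent {u z : ℂ} (huz : u * z = -1) {d e : Fin K → ℂ}
    (he : ∀ k, e k = u * d k)
    (hunit : IsUnit (1 + u • ∑ k, (1 + u * d k)⁻¹ • gram R k)) :
    detEquiv R e z = u • perturbedResolvent (gram R) (u, d) := by
  have hu : u ≠ 0 := fun h => by simp [h] at huz
  refine Matrix.inv_eq_right_inv ?_
  have hpencil : (1 / (K : ℂ)) • ∑ j, (1 / (1 + e j)) • (R j * (R j)ᴴ) -
      z • (1 : Matrix (Fin N) (Fin N) ℂ) =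
        u⁻¹ • (1 + u • ∑ k, (1 + u * d k)⁻¹ • gram R k) := by
    have hz : z = -u⁻¹ := by field_simp; linear_combination huz
    rw [smul_add, smul_smul, inv_mul_cancel₀ hu, one_smul, hz, neg_smul, sub_neg_eq_add, add_comm,
      Finset.smul_sum]
    congr 1
    refine Finset.sum_congr rfl fun k _ => ?_
    rw [gram, smul_smul, smul_smul, he, one_div (1 + _), mul_comm]
  rw [hpencil, smul_mul_smul_comm, inv_mul_cancel₀ hu, one_smul]
  exact Ring.mul_inverse_cancel _ hunit

/-- High up on the imaginary axis every solution in `𝒮^K` of the implicit equations is given by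
the solution which is analytic at infinity. -/
theorem eventually_detEquiv_eq {δ : Fin K → ℂ → ℂ} (hδ : IsFundamentalSolution R δ)
    {d : ℂ → Fin K → ℂ}
    (huniq : ∀ᶠ p in 𝓝 ((0 : ℂ), fun k => gramTrace R k 1),
      p.2 = fixedPointMap (gram R) (gramTrace R) p → p.2 = d p.1) :
    ∀ᶠ t : ℝ in 𝓝[>] 0, detEquiv R (fun k => δ k (Complex.I * (t⁻¹ : ℝ))) (Complex.I * (t⁻¹ : ℝ)) =
      (Complex.I * t) • perturbedResolvent (gram R) (Complex.I * t, d (Complex.I * t)) := by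
  choose l hl using fun k => (hδ.mem_classS k).finite_limit
  -- This is `δ/u` for `u = it`, `z = i/t`.
  set e : ℝ → Fin K → ℂ :=
    fun t k => -Complex.I * (t⁻¹ : ℝ) * δ k (Complex.I * (t⁻¹ : ℝ)) with he
  have hu : Tendsto (fun t : ℝ => Complex.I * (t : ℂ)) (𝓝[>] 0) (𝓝 0) := by
    have : Continuous fun t : ℝ => Complex.I * (t : ℂ) := by fun_prop
    simpa using (this.tendsto 0).mono_left nhdsWithin_le_nhds
  have he_lim : Tendsto e (𝓝[>] 0) (𝓝 fun k => (l k : ℂ)) :=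
    tendsto_pi_nhds.2 fun k => (hl k).comp tendsto_inv_nhdsGT_zero
  have hp := hu.prodMk_nhds he_lim
  have hδe (t : ℝ) (ht : 0 < t) (k : Fin K) :
      δ k (Complex.I * (t⁻¹ : ℝ)) = Complex.I * t * e t k := by
    have ht' : (t : ℂ) ≠ 0 := Complex.ofReal_ne_zero.2 ht.ne'
    simp only [he, Complex.ofReal_inv]
    field_simp
    linear_combination δ k (Complex.I / t) * Complex.I_sq
  have huz (t : ℝ) (ht : 0 < t) : Complex.I * t * (Complex.I * (t⁻¹ : ℝ)) = -1 := by
    have ht' : (t : ℂ) ≠ 0 := Complex.ofReal_ne_zero.2 ht.ne'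
    rw [Complex.ofReal_inv]
    field_simp
    exact Complex.I_sq
  -- Convergence of `e` to any limit suffices here: the matrix to be inverted tends to `1`.
  have hdet : ∀ᶠ t : ℝ in 𝓝[>] 0,
      detEquiv R (fun k => δ k (Complex.I * (t⁻¹ : ℝ))) (Complex.I * (t⁻¹ : ℝ)) =
        (Complex.I * t) • perturbedResolvent (gram R) (Complex.I * t, e t) := by
    have hlim := (contDiffAt_perturbedPencil (gram R) (fun k => (l k : ℂ))
      (n := 0)).continuousAt.tendsto.comp hp
    rw [zero_smul, add_zero] at hlim
    filter_upwards [hlim.eventually (Units.nhds 1), self_mem_nhdsWithin] with t hunit ht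
    exact detEquiv_eq_smul_perturbedResolvent R (huz t ht) (hδe t ht) hunit
  have hfix : ∀ᶠ t : ℝ in 𝓝[>] 0,
      e t = fixedPointMap (gram R) (gramTrace R) (Complex.I * t, e t) := by
    filter_upwards [hdet, self_mem_nhdsWithin] with t hdet ht
    have hIt : Complex.I * (t : ℂ) ≠ 0 :=
      mul_ne_zero Complex.I_ne_zero (Complex.ofReal_ne_zero.2 (ne_of_gt ht))
    funext k
    refine mul_left_cancel₀ hIt ?_
    rw [← hδe t ht, hδ.eqn _ (fun x _ h => ?_) k, hdet, ← gramTrace_apply, map_smul, smul_eq_mul]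
    · rfl
    have him := congrArg Complex.im h
    rw [Complex.I_mul_im, Complex.ofReal_re, Complex.ofReal_im] at him
    exact (inv_pos.2 ht).ne' him
  -- Passing to the limit in the fixed-point equation identifies the limit `l`, which places `e` in
  -- the neighbourhood where the solution is unique.
  have he_lim' : Tendsto e (𝓝[>] 0) (𝓝 fun k => gramTrace R k 1) := by
    have := (contDiffAt_fixedPointMap (gram R) (gramTrace R) (fun k => (l k : ℂ))
      (n := 0)).continuousAt.tendsto.comp hp
    rw [show fixedPointMap (gram R) (gramTrace R) (0, fun k => (l k : ℂ)) =
      fun k => gramTrace R k 1 from fixedPointMap_zero _ _ _] at this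
    exact this.congr' (hfix.mono fun t ht => ht.symm)
  filter_upwards [hdet, hfix, (hu.prodMk_nhds he_lim').eventually huniq] with t hdet hfix huniq
  rw [hdet, ← huniq hfix]

end Matrices

-- The transform of `F` in the variable `u`

theorem ae_nonneg_of_support_subset {F : Measure ℝ} (h : F.support ⊆ Set.Ici 0) :
    ∀ᵐ x ∂F, 0 ≤ x :=
  mem_of_superset Measure.support_mem_ae h

theorem integral_inv_one_add_mul_eq {F : Measure ℝ} {u z : ℂ} (huz : u * z = -1) :
    ∫ x : ℝ, (1 + u * x)⁻¹ ∂F = u⁻¹ * resolventTransform F z := by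
  have hu : u ≠ 0 := fun h => by simp [h] at huz
  rw [resolventTransform_apply, ← integral_const_mul]
  refine integral_congr_ae (ae_of_all _ fun x => ?_)
  simp only [resolvent, Ring.inverse_eq_inv', Complex.coe_algebraMap]
  rw [← mul_inv]
  congr 1
  linear_combination huz

open scoped Matrix.Norms.Operator in
/-- The transform of `F` agrees along the imaginary axis with an analytic function, whose Taylor
coefficients are given by the recursion. -/
theorem exists_analytic_transform {N K : ℕ} {R : Fin K → Matrix (Fin N) (Fin N) ℂ} {F : Measure ℝ}
    (hF : IsDetEquivDistribution R F) : ∃ H : ℂ → ℂ, AnalyticAt ℂ H 0 ∧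
      (∀ᶠ t : ℝ in 𝓝[>] 0, ∫ x : ℝ, (1 + Complex.I * t * x)⁻¹ ∂F = H (Complex.I * t)) ∧
      ∀ n, iteratedDeriv n H 0 = (1 / (N : ℂ)) * (T R n).trace := by
  obtain ⟨d, hd, hfix, huniq⟩ := exists_analytic_solution (gram R) (gramTrace R)
  obtain ⟨δ, hδ, hst⟩ := hF.stieltjes
  refine ⟨fun u => normalizedTrace N (perturbedResolvent (gram R) (u, d u)), ?_, ?_, ?_⟩
  · exact ((normalizedTrace N).analyticAt _).comp (analyticAt_perturbedResolvent (gram R) hd)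
  · filter_upwards [eventually_detEquiv_eq R hδ huniq, self_mem_nhdsWithin] with t hdet ht
    have ht' : (t : ℂ) ≠ 0 := Complex.ofReal_ne_zero.2 (ne_of_gt ht)
    have huz : Complex.I * t * (Complex.I * (t⁻¹ : ℝ)) = -1 := by
      rw [Complex.ofReal_inv]
      field_simp
      exact Complex.I_sq
    rw [integral_inv_one_add_mul_eq huz, hst _ (fun x _ h => ?_), hdet, Matrix.trace_smul,
      normalizedTrace_apply, smul_eq_mul]
    · have hI := Complex.I_ne_zero
      field_simp
    · have him := congrArg Complex.im h
      rw [Complex.I_mul_im, Complex.ofReal_re, Complex.ofReal_im] at him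
      exact (inv_pos.2 ht).ne' him
  · exact iteratedDeriv_normalizedTrace_perturbedResolvent R hd hfix

end AsymptoticMoments

end

theorem theorem2 (N K : ℕ) (hN : 0 < N) (hK : 0 < K)
    (R : Fin K → Matrix (Fin N) (Fin N) ℂ)
    (F : MeasureTheory.Measure ℝ) (hF : AsymptoticMoments.IsDetEquivDistribution R F) (n : ℕ) :
    MeasureTheory.Integrable (fun x : ℝ => x ^ n) F ∧
      ((∫ x in Set.Ici (0 : ℝ), x ^ n ∂F : ℝ) : ℂ) =
        (-1) ^ n / (n.factorial : ℂ) * ((1 / (N : ℂ)) * (AsymptoticMoments.T R n).trace) := by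
  have := hF.isProbabilityMeasure
  have hpos := AsymptoticMoments.ae_nonneg_of_support_subset hF.support_subset
  obtain ⟨H, hH, heq, hder⟩ := AsymptoticMoments.exists_analytic_transform hF
  obtain ⟨hint, hval⟩ := AsymptoticMoments.integrable_pow_and_integral_pow hpos hH heq n
  refine ⟨hint, ?_⟩
  rw [MeasureTheory.Measure.restrict_eq_self_of_ae_mem (s := Set.Ici 0) hpos, hval, hder]
  ring
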